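/- Let $d\ge 1$, write $\langle x\rangle=\sqrt{1+|x|^2}$ for $x\in\mathbb R^d$ and $D_a x=(a x_1,x_2,\dots,x_d)$, and let $\hat f(\xi)=\int f(x)e^{-2\pi i x\cdot\xi}\,dx$ be the Fourier transform. Consider a ridgelet system on $\mathbb R^d$: for each $j\in\mathbb N_0$ there are directions $s_{j,\ell}\in\mathbb S^{d-1}$, $\ell\in\{0,\dots,L_j\}$, with $L_j+1\lesssim 2^{j(d-1)}$; orthogonal matrices $R_{j,\ell}$ with $R_{j,\ell}s_{j,\ell}=e_1$; and functions $\psi_{j,\ell}$ with real-valued $\hat\psi_{j,\ell}$ satisfying $\sum_{j}\sum_{\ell}\hat\psi_{j,\ell}^2=1$ on $\mathbb R^d$, where $\hat\psi_{j,\ell}$ vanishes outside $\{2^{j-1}<|\xi|<2^{j+1},\ |\xi/|\xi|-s_{j,\ell}|<2^{-j+1}\}$ if $j\ge1$ and outside $\{|\xi|<2\}$ if $j=0$. Put $U_{j,\ell}=R_{j,\ell}^{-1}D_{2^{-j}}$ and $$\varphi_{j,\ell,k}(x)=2^{-j/2}\,\psi_{j,\ell}(x-U_{j,\ell}k),\qquad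 j\in\mathbb N_0,\ 0\le \ell\le L_j,\ k\in\mathbb Z^d .$$ Let $m\in\mathbb N_0$, and assume that the functions $\eta\mapsto\hat\psi_{j,\ell}(U_{j,\ell}^{-\top}\eta)$ are $C^N$ for some $N\in\mathbb N\cup\{\infty\}$ with $N\ge 2m+d+1$, and that, for each finite $n\le N$, their derivatives of order $n$ are bounded uniformly in $j,\ell$ and $\eta$. Then there is a constant $C>0$, depending only on the ridgelet system and on $m$, such that for every $f\in L^2(\mathbb R^d)$ and $A\in\mathbb R$ with $|f(x)|\le A\langle x\rangle^{-2m}$ for almost every $x$, and for all $j\in\mathbb N_0$, $0\le\ell\le L_j$ and $k=(k_1,k')\in\mathbb Z\times\mathbb Z^{d-1}$, the function $\overline{\varphi_{j,\ell,k}}\,f$ is integrable and $$\bigl|\langle\varphi_{j,\ell,k},f\rangle\bigr|=\Bigl|\int_{\mathbb R^d}\overline{\varphi_{j,\ell,k}(x)}\,f(x)\,dx\Bigr|\le C A\,\frac{2^{-j/2}}{\bigl((k_1/2^j)^2+|k'|^2+1\bigr)^m}.$$ -/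

import Mathlib

open MeasureTheory
open scoped FourierTransform ComplexConjugate

noncomputable section

namespace Ridgelet

/-- The space `ℝ^d` with its Euclidean norm. -/
abbrev Space (d : ℕ) : Type := EuclideanSpace ℝ (Fin d)

/-- The regularised absolute value `⟨x⟩ = √(1 + |x|²)`. -/
def regAbs {d : ℕ} (x : Space d) : ℝ := Real.sqrt (1 + ‖x‖ ^ 2)

/-- The first canonical unit vector `e₁` of `ℝ^d` (the first coordinate has index `0`). -/
def e₁ (d : ℕ) [NeZero d] : Space d := EuclideanSpace.single (0 : Fin d) (1 : ℝ)

/-- `D_a`, the dilation of the first component: `D_a x = (a x₁, x₂, …, x_d)`. -/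
def dil {d : ℕ} [NeZero d] (a : ℝ) (x : Space d) : Space d :=
  WithLp.toLp 2 (fun i => if i = 0 then a * x i else x i)

/-- An integer vector as a vector of `ℝ^d`. -/
def intVec {d : ℕ} (k : Fin d → ℤ) : Space d := WithLp.toLp 2 (fun i => (k i : ℝ))

/-- `|k'|²`, where `k' = (k₂, …, k_d)` consists of all components but the first. -/
def tailNormSq {d : ℕ} [NeZero d] (k : Fin d → ℤ) : ℝ :=
  ∑ i ∈ Finset.univ.erase (0 : Fin d), (k i : ℝ) ^ 2

/-- The polar rectangle in frequency at scale `j` in direction `s`. For `j ≥ 1` it is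
`2^(j-1) < |ξ| < 2^(j+1)`, `ξ/|ξ| ∈ B(s, 2^(-j+1))`, the ball being taken in the sphere; at the
coarsest scale `j = 0` it is the whole low-frequency ball `|ξ| < 2`, as it must be for the
rectangles to cover the frequency space. -/
def polarRect {d : ℕ} (j : ℕ) (s : Metric.sphere (0 : Space d) 1) : Set (Space d) :=
  if j = 0 then {ξ | ‖ξ‖ < 2}
  else {ξ | (2 : ℝ) ^ ((j : ℤ) - 1) < ‖ξ‖ ∧ ‖ξ‖ < (2 : ℝ) ^ ((j : ℤ) + 1) ∧
    dist (‖ξ‖⁻¹ • ξ) (s : Space d) < (2 : ℝ) ^ (-(j : ℤ) + 1)}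

/-- The data from which a ridgelet frame on `ℝ^d` is built. -/
structure System (d : ℕ) [NeZero d] where
  /-- The directions at scale `j` are indexed by `ℓ ∈ {0, …, L j}`. -/
  L : ℕ → ℕ
  /-- The directions `s_{j,ℓ}`. -/
  s : (j : ℕ) → Fin (L j + 1) → Metric.sphere (0 : Space d) 1
  /-- At scale `j` there are `≲ 2^(j(d-1))` directions. -/
  card_le : ∃ c : ℝ, ∀ j : ℕ, (L j : ℝ) + 1 ≤ c * (2 : ℝ) ^ (j * (d - 1))
  /-- The (arbitrary but fixed) orthogonal transformation `R_{j,ℓ}`. -/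
  R : (j : ℕ) → Fin (L j + 1) → (Space d ≃ₗᵢ[ℝ] Space d)
  /-- `R_{j,ℓ}` maps `s_{j,ℓ}` to `e₁`. -/
  R_s : ∀ j ℓ, R j ℓ (s j ℓ : Space d) = e₁ d
  /-- The frequency windows, i.e. the Fourier transforms of the functions `ψ_{j,ℓ}`. -/
  psiHat : (j : ℕ) → Fin (L j + 1) → Space d → ℝ
  /-- The squares of the frequency windows form a partition of unity. -/
  partition : ∀ ξ, HasSum (fun j : ℕ => ∑ ℓ : Fin (L j + 1), psiHat j ℓ ξ ^ 2) 1
  /-- The frequency windows vanish outside the polar rectangles. -/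
  support_subset : ∀ j ℓ, Function.support (psiHat j ℓ) ⊆ polarRect j (s j ℓ)

namespace System

variable {d : ℕ} [NeZero d] (Φ : System d)

/-- The function `ψ_{j,ℓ}`: inverse Fourier transform (with kernel `exp (2π i x·ξ)`) of its
frequency window. -/
def psi (j : ℕ) (ℓ : Fin (Φ.L j + 1)) : Space d → ℂ :=
  𝓕⁻ (fun ξ : Space d => (Φ.psiHat j ℓ ξ : ℂ))

/-- `U_{j,ℓ} = R_{j,ℓ}⁻¹ D_{2^(-j)}`. -/
def U (j : ℕ) (ℓ : Fin (Φ.L j + 1)) (x : Space d) : Space d :=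
  (Φ.R j ℓ).symm (dil ((2 : ℝ) ^ (-(j : ℤ))) x)

/-- `U_{j,ℓ}^{-⊤} = R_{j,ℓ}⁻¹ D_{2^j}`, the inverse transpose of `U_{j,ℓ}`. -/
def UinvT (j : ℕ) (ℓ : Fin (Φ.L j + 1)) (η : Space d) : Space d :=
  (Φ.R j ℓ).symm (dil ((2 : ℝ) ^ (j : ℤ)) η)

/-- `UinvT` is the inverse transpose of `U`. -/
theorem inner_UinvT_U (j : ℕ) (ℓ : Fin (Φ.L j + 1)) (η x : Space d) :
    inner ℝ (Φ.UinvT j ℓ η) (Φ.U j ℓ x) = inner ℝ η x := by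
  unfold UinvT U
  rw [LinearIsometryEquiv.inner_map_map]
  simp only [dil, PiLp.inner_apply]
  refine Finset.sum_congr rfl fun i _ => ?_
  by_cases h : i = 0
  · simp only [h, if_true, RCLike.inner_apply, conj_trivial, zpow_neg]
    field_simp
  · simp only [h, if_false]

/-- The transformed window `η ↦ ψ̂_{j,ℓ}(U_{j,ℓ}^{-⊤} η)`. -/
def window (j : ℕ) (ℓ : Fin (Φ.L j + 1)) (η : Space d) : ℝ :=
  Φ.psiHat j ℓ (Φ.UinvT j ℓ η)

/-- The transformed windows are `C^N`, with all derivatives up to order `N` bounded independently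
of `j` and `ℓ` (`N = ⊤` stands for smooth windows and all orders). -/
def WindowsBounded (N : ℕ∞) : Prop :=
  (∀ j ℓ, ContDiff ℝ N (Φ.window j ℓ)) ∧
  ∀ n : ℕ, (n : ℕ∞) ≤ N → ∃ β : ℝ, ∀ j ℓ η, ‖iteratedFDeriv ℝ n (Φ.window j ℓ) η‖ ≤ β

/-- The ridgelet `φ_{j,ℓ,k}(x) = 2^(-j/2) ψ_{j,ℓ}(x - U_{j,ℓ} k)`. -/
def ridgelet (j : ℕ) (ℓ : Fin (Φ.L j + 1)) (k : Fin d → ℤ) (x : Space d) : ℂ :=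
  (((2 : ℝ) ^ (-(j : ℝ) / 2) : ℝ) : ℂ) * Φ.psi j ℓ (x - Φ.U j ℓ (intVec k))

/-- The ridgelet coefficient `⟨φ_{j,ℓ,k}, f⟩`, antilinear in the first argument. -/
def coeff (f : Space d → ℂ) (j : ℕ) (ℓ : Fin (Φ.L j + 1)) (k : Fin d → ℤ) : ℂ :=
  ∫ x, conj (Φ.ridgelet j ℓ k x) * f x

end System

end Ridgelet

end

/-!
In the coordinates `y = U⁻¹ x`, where `U = U_{j,ℓ}`, all ridgelets look alike. The substitution
`ξ = U⁻ᵀ η` gives `ψ_{j,ℓ}(x) = |det U|⁻¹ G_{j,ℓ}(U⁻¹ x)`, where `G_{j,ℓ}` is the inverse Fourier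
transform of the transformed window (`Ridgelet.System.psi_eq`). The windows live in a fixed ball
(`Ridgelet.System.support_window_subset`) and their derivatives up to order `2m + d + 1` are
uniformly bounded, so integration by parts yields
`|G_{j,ℓ}(y)| ≲ (1 + |y|)^(-(2m+d+1))` uniformly in `j, ℓ`
(`Ridgelet.System.exists_norm_fourierInv_window_le`).

Write `x = U k + U z`. Since `U` is a contraction, Peetre's inequality
(`Ridgelet.inv_mul_inv_weight_le`) lets `2m` orders of this decay in `z` convert the factor
`⟨x⟩^(-2m)` from `f` into `⟨U k⟩^(-2m)`, and `⟨U k⟩² = (k₁/2^j)² + |k'|² + 1`. The remaining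
`d + 1` orders are integrable in `z`, and the Jacobian of `z = U⁻¹ x - k` cancels `|det U|⁻¹`.
-/

/-! ### Linear changes of variables -/

/-- The Jacobian is not evaluated for the ridgelet dilations: it enters their estimate twice, with
opposite exponents, and cancels. -/
theorem integral_comp_linearEquiv {E G : Type*} [NormedAddCommGroup E] [InnerProductSpace ℝ E]
    [FiniteDimensional ℝ E] [MeasurableSpace E] [BorelSpace E] [NormedAddCommGroup G]
    [NormedSpace ℝ G] (D : E ≃ₗ[ℝ] E) (F : E → G) :
    ∫ x, F (D x) = |LinearMap.det (D.symm : E →ₗ[ℝ] E)| • ∫ x, F x := by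
  have hD : LinearMap.det (D : E →ₗ[ℝ] E) ≠ 0 := D.isUnit_det'.ne_zero
  have hmap := Measure.map_linearMap_addHaar_eq_smul_addHaar (volume : Measure E) hD
  have h := integral_map_equiv (μ := volume)
    D.toContinuousLinearEquiv.toHomeomorph.toMeasurableEquiv F
  have hmap' : Measure.map D.toContinuousLinearEquiv.toHomeomorph.toMeasurableEquiv
      (volume : Measure E) = ENNReal.ofReal |(LinearMap.det (D : E →ₗ[ℝ] E))⁻¹| • volume := hmap
  rw [hmap', integral_smul_measure, ENNReal.toReal_ofReal (abs_nonneg _)] at h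
  rw [LinearEquiv.det_coe_symm]
  exact h.symm

theorem integrable_comp_linearEquiv {E G : Type*} [NormedAddCommGroup E] [InnerProductSpace ℝ E]
    [FiniteDimensional ℝ E] [MeasurableSpace E] [BorelSpace E] [NormedAddCommGroup G]
    (D : E ≃ₗ[ℝ] E) {F : E → G} (hF : Integrable F) : Integrable fun x => F (D x) := by
  have hD : LinearMap.det (D : E →ₗ[ℝ] E) ≠ 0 := D.isUnit_det'.ne_zero
  have hmap : Measure.map D.toContinuousLinearEquiv.toHomeomorph.toMeasurableEquiv
      (volume : Measure E) = ENNReal.ofReal |(LinearMap.det (D : E →ₗ[ℝ] E))⁻¹| • volume :=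
    Measure.map_linearMap_addHaar_eq_smul_addHaar (volume : Measure E) hD
  have h := (integrable_map_equiv (μ := volume)
    D.toContinuousLinearEquiv.toHomeomorph.toMeasurableEquiv F).1
  rw [hmap] at h
  exact h (hF.smul_measure ENNReal.ofReal_ne_top)

/-! ### Uniform decay of inverse Fourier transforms -/

section FourierDecay

variable {E : Type*} [NormedAddCommGroup E] [InnerProductSpace ℝ E] [FiniteDimensional ℝ E]
  [MeasurableSpace E] [BorelSpace E]

theorem integrable_iteratedFDeriv_of_support_subset {g : E → ℂ} {n p : ℕ} (hg : ContDiff ℝ n g)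
    {r : ℝ} (hr : Function.support g ⊆ Metric.closedBall 0 r) (hp : p ≤ n) :
    Integrable (iteratedFDeriv ℝ p g) := by
  have hc : HasCompactSupport g :=
    HasCompactSupport.of_support_subset_isCompact (isCompact_closedBall 0 r) hr
  exact (hg.continuous_iteratedFDeriv (by exact_mod_cast hp)).integrable_of_hasCompactSupport
    (hc.iteratedFDeriv p)

theorem integral_norm_iteratedFDeriv_le {g : E → ℂ} {p : ℕ} {r β : ℝ}
    (hr : Function.support g ⊆ Metric.closedBall 0 r)
    (hβ : ∀ x, ‖iteratedFDeriv ℝ p g x‖ ≤ β) :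
    ∫ x, ‖iteratedFDeriv ℝ p g x‖ ≤ β * volume.real (Metric.closedBall (0 : E) r) := by
  have hs : Function.support (iteratedFDeriv ℝ p g) ⊆ Metric.closedBall 0 r :=
    (support_iteratedFDeriv_subset p).trans
      (closure_minimal hr Metric.isClosed_closedBall)
  rw [← setIntegral_eq_integral_of_forall_compl_eq_zero (s := Metric.closedBall (0 : E) r)
    fun x hx => by
      rw [norm_eq_zero]
      by_contra h
      exact hx (hs h)]
  refine (Real.le_norm_self _).trans (norm_setIntegral_le_of_norm_le_const ?_ fun x _ => ?_)
  · exact (isCompact_closedBall (0 : E) r).measure_lt_top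
  · rw [norm_norm]
    exact hβ x

/-- Integration by parts: functions supported in a fixed ball, with derivatives up to order `n`
under a common bound, have inverse Fourier transforms decaying to order `n` with a common
constant. -/
theorem exists_norm_fourierInv_le (n : ℕ) (r β : ℝ) : ∃ C : ℝ, 0 ≤ C ∧ ∀ g : E → ℂ,
    ContDiff ℝ n g → Function.support g ⊆ Metric.closedBall 0 r →
    (∀ p ≤ n, ∀ x, ‖iteratedFDeriv ℝ p g x‖ ≤ β) →
    ∀ y, ‖𝓕⁻ g y‖ ≤ C * ((1 + ‖y‖) ^ n)⁻¹ := by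
  set V := volume.real (Metric.closedBall (0 : E) r) with hV
  have hV0 : 0 ≤ V := measureReal_nonneg
  refine ⟨2 ^ n * (|β| * V + 2 ^ n * ((n + 1) * (|β| * V))), by positivity, fun g hg hr hβ y => ?_⟩
  have hint : ∀ p ≤ n, ∫ x, ‖iteratedFDeriv ℝ p g x‖ ≤ |β| * V := fun p hp =>
    (integral_norm_iteratedFDeriv_le hr (hβ p hp)).trans (by gcongr; exact le_abs_self β)
  have key : ∀ p ≤ n, ‖y‖ ^ p * ‖𝓕⁻ g y‖ ≤ 2 ^ p * ((p + 1) * (|β| * V)) := by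
    intro p hp
    have h := Real.pow_mul_norm_iteratedFDeriv_fourier_le (K := 0) (N := (n : ℕ∞))
      (k := 0) (n := p) hg (fun k q hk hq => by
        have hk0 : k = 0 := by simpa using hk
        subst hk0
        simpa using (integrable_iteratedFDeriv_of_support_subset hg hr
          (by exact_mod_cast hq)).norm) (by simp) (by exact_mod_cast hp) (-y)
    rw [← norm_neg y, Real.fourierInv_eq_fourier_neg]
    rw [norm_iteratedFDeriv_zero] at h
    refine h.trans ?_
    simp only [pow_zero, Nat.cast_zero, mul_zero, zero_add, one_mul, Finset.range_one,
      Finset.singleton_product, Finset.sum_map, Function.Embedding.coeFn_mk]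
    gcongr
    refine (Finset.sum_le_card_nsmul _ _ (|β| * V) fun q hq => ?_).trans_eq ?_
    · exact hint q ((Nat.lt_succ_iff.1 (Finset.mem_range.1 hq)).trans hp)
    · simp
  have h0 := key 0 (Nat.zero_le n)
  have hn := key n le_rfl
  simp only [pow_zero, one_mul, Nat.cast_zero, zero_add] at h0
  rw [← div_eq_mul_inv, le_div_iff₀ (by positivity), mul_comm]
  have hpow : (1 + ‖y‖) ^ n ≤ 2 ^ n * (1 + ‖y‖ ^ n) := by
    have hy : 0 ≤ ‖y‖ := norm_nonneg y
    calc (1 + ‖y‖) ^ n ≤ (2 * max 1 ‖y‖) ^ n := by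
          gcongr
          linarith [le_max_left 1 ‖y‖, le_max_right 1 ‖y‖]
      _ = 2 ^ n * max 1 ‖y‖ ^ n := mul_pow _ _ _
      _ ≤ 2 ^ n * (1 + ‖y‖ ^ n) := by
          gcongr
          rcases max_choice 1 ‖y‖ with h | h <;> rw [h]
          · rw [one_pow]
            linarith [pow_nonneg hy n]
          · linarith
  calc (1 + ‖y‖) ^ n * ‖𝓕⁻ g y‖ ≤ 2 ^ n * (1 + ‖y‖ ^ n) * ‖𝓕⁻ g y‖ := by gcongr
    _ = 2 ^ n * (‖𝓕⁻ g y‖ + ‖y‖ ^ n * ‖𝓕⁻ g y‖) := by ring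
    _ ≤ _ := by gcongr

end FourierDecay

/-! ### The anisotropic dilation and the weight -/

namespace Ridgelet

variable {d : ℕ} [NeZero d]

/-- The anisotropic dilation `D_a`, `a ≠ 0`, as a linear automorphism. -/
noncomputable def dilEquiv (a : ℝ) (ha : a ≠ 0) : Space d ≃ₗ[ℝ] Space d where
  toFun := dil a
  invFun := dil a⁻¹
  map_add' x y := by ext i; by_cases h : i = 0 <;> simp [dil, h, mul_add]
  map_smul' c x := by ext i; by_cases h : i = 0 <;> simp [dil, h, mul_left_comm]
  left_inv x := by ext i; by_cases h : i = 0 <;> simp [dil, h, ha]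
  right_inv x := by ext i; by_cases h : i = 0 <;> simp [dil, h, ha]

theorem inner_dil_left (a : ℝ) (x y : Space d) : inner ℝ (dil a x) y = inner ℝ x (dil a y) := by
  simp only [dil, PiLp.inner_apply]
  refine Finset.sum_congr rfl fun i _ => ?_
  by_cases h : i = 0 <;> simp [h, mul_left_comm, mul_assoc]

theorem norm_dil_sq (a : ℝ) (x : Space d) :
    ‖dil a x‖ ^ 2 = (a * x 0) ^ 2 + ∑ i ∈ Finset.univ.erase (0 : Fin d), x i ^ 2 := by
  rw [EuclideanSpace.real_norm_sq_eq, ← Finset.add_sum_erase _ _ (Finset.mem_univ (0 : Fin d))]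
  refine congrArg₂ (· + ·) (by simp [dil]) (Finset.sum_congr rfl fun i hi => ?_)
  simp [dil, Finset.ne_of_mem_erase hi]

theorem norm_dil_le {a : ℝ} (ha : 0 ≤ a) (ha1 : a ≤ 1) (x : Space d) : ‖dil a x‖ ≤ ‖x‖ := by
  refine le_of_sq_le_sq ?_ (norm_nonneg x)
  rw [norm_dil_sq, EuclideanSpace.real_norm_sq_eq,
    ← Finset.add_sum_erase _ _ (Finset.mem_univ (0 : Fin d)), mul_pow]
  gcongr
  exact mul_le_of_le_one_left (sq_nonneg _) (pow_le_one₀ ha ha1)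

theorem dil_e₁ (a : ℝ) : dil a (e₁ d) = a • e₁ d := by
  ext i
  by_cases h : i = 0 <;> simp [dil, e₁, h]

theorem regAbs_zpow {d : ℕ} (x : Space d) (m : ℕ) :
    regAbs x ^ (-(2 * (m : ℤ))) = ((1 + ‖x‖ ^ 2) ^ m)⁻¹ := by
  have h : (0 : ℝ) ≤ 1 + ‖x‖ ^ 2 := by positivity
  rw [zpow_neg, zpow_mul, zpow_natCast, zpow_ofNat, regAbs, Real.sq_sqrt h]

/-- Peetre's inequality for the weight `1 + |x|²`. -/
theorem one_add_norm_sq_le {E : Type*} [SeminormedAddCommGroup E] (a b : E) :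
    1 + ‖a‖ ^ 2 ≤ 2 * (1 + ‖a + b‖ ^ 2) * (1 + ‖b‖ ^ 2) := by
  have h : ‖a‖ ≤ ‖a + b‖ + ‖b‖ := by
    simpa using norm_sub_le (a + b) b
  have h2 : ‖a‖ ^ 2 ≤ (‖a + b‖ + ‖b‖) ^ 2 := by gcongr
  nlinarith [sq_nonneg (‖a + b‖ - ‖b‖), sq_nonneg (‖a + b‖ * ‖b‖)]

/-- Peetre's inequality trades `2m` orders of decay in `z` for the weight at `a`. -/
theorem inv_mul_inv_weight_le {E : Type*} [SeminormedAddCommGroup E] (m q : ℕ) {a b z : E}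
    (hb : ‖b‖ ≤ ‖z‖) :
    ((1 + ‖z‖) ^ (2 * m + q))⁻¹ * ((1 + ‖a + b‖ ^ 2) ^ m)⁻¹ ≤
      2 ^ m * ((1 + ‖a‖ ^ 2) ^ m)⁻¹ * ((1 + ‖z‖) ^ q)⁻¹ := by
  have hz : 0 ≤ ‖z‖ := norm_nonneg z
  have h1 : 1 + ‖a‖ ^ 2 ≤ 2 * (1 + ‖a + b‖ ^ 2) * (1 + ‖z‖) ^ 2 := by
    refine (one_add_norm_sq_le a b).trans ?_
    gcongr
    have : ‖b‖ ^ 2 ≤ ‖z‖ ^ 2 := by gcongr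
    nlinarith
  have h2 := pow_le_pow_left₀ (by positivity) h1 m
  rw [mul_pow, mul_pow, ← pow_mul] at h2
  have hA : 0 < (1 + ‖a‖ ^ 2) ^ m := by positivity
  have hB : 0 < (1 + ‖a + b‖ ^ 2) ^ m := by positivity
  have hZ : 0 < (1 + ‖z‖) ^ (2 * m) := by positivity
  have hQ : 0 < (1 + ‖z‖) ^ q := by positivity
  rw [pow_add, mul_inv, mul_right_comm]
  refine mul_le_mul_of_nonneg_right ?_ (inv_nonneg.2 hQ.le)
  rw [← mul_inv, ← div_eq_mul_inv, le_div_iff₀ hA, ← div_eq_inv_mul, div_le_iff₀ (by positivity)]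
  linarith

/-! ### Uniform estimates for the ridgelets -/

namespace System

variable (Φ : System d)

/-- The constraints `|ξ| < 2^(j+1)` and `|ξ/|ξ| - s| < 2^(1-j)` balance: rotating `ξ` and
contracting its first component by `2^j` leaves a vector of bounded length. -/
theorem support_window_subset (j : ℕ) (ℓ : Fin (Φ.L j + 1)) :
    Function.support (Φ.window j ℓ) ⊆ Metric.closedBall 0 6 := by
  intro η hη
  set a : ℝ := (2 : ℝ) ^ (j : ℤ) with ha
  have ha1 : 1 ≤ a := by rw [ha, zpow_natCast]; exact one_le_pow₀ one_le_two
  have ha0 : 0 < a := one_pos.trans_le ha1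
  have hai : a⁻¹ ≤ 1 := inv_le_one_of_one_le₀ ha1
  set ξ := Φ.UinvT j ℓ η with hξ
  have hmem : ξ ∈ polarRect j (Φ.s j ℓ) := Φ.support_subset j ℓ hη
  have hη' : η = (dilEquiv (d := d) a ha0.ne').symm (Φ.R j ℓ ξ) := by
    rw [LinearEquiv.eq_symm_apply, hξ, UinvT, LinearIsometryEquiv.apply_symm_apply]
    rfl
  rw [mem_closedBall_zero_iff]
  unfold polarRect at hmem
  split_ifs at hmem with hj
  · have h2 : ‖ξ‖ < 2 := hmem
    have : ‖η‖ ≤ ‖ξ‖ := by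
      rw [hη', ← (Φ.R j ℓ).norm_map ξ]
      exact norm_dil_le (inv_nonneg.2 ha0.le) hai _
    linarith
  · obtain ⟨hpos, hlt, hdist⟩ := hmem
    have hξ0 : 0 < ‖ξ‖ := lt_trans (by positivity) hpos
    rw [zpow_add₀ two_ne_zero, zpow_one, ← ha] at hlt
    rw [zpow_add₀ two_ne_zero, zpow_one, zpow_neg, ← ha, dist_eq_norm] at hdist
    set v := ‖ξ‖⁻¹ • ξ - (Φ.s j ℓ : Space d) with hv
    have hdecomp : ξ = ‖ξ‖ • (Φ.s j ℓ : Space d) + ‖ξ‖ • v := by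
      rw [hv, smul_sub, smul_inv_smul₀ hξ0.ne']
      abel
    have hη2 : η = (‖ξ‖ * a⁻¹) • e₁ d + ‖ξ‖ • dil a⁻¹ (Φ.R j ℓ v) := by
      rw [hη']
      conv_lhs => rw [hdecomp]
      simp only [map_add, map_smul, Φ.R_s]
      congr 1
      rw [mul_smul]
      exact congrArg _ (dil_e₁ a⁻¹)
    have he : ‖e₁ d‖ = 1 := by simp [e₁]
    have hRv : ‖dil a⁻¹ (Φ.R j ℓ v)‖ ≤ a⁻¹ * 2 :=
      (norm_dil_le (inv_nonneg.2 ha0.le) hai _).trans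
        (((Φ.R j ℓ).norm_map v).trans_le hdist.le)
    rw [hη2]
    have hq : ‖ξ‖ * a⁻¹ ≤ 2 := by
      rw [← div_eq_mul_inv, div_le_iff₀ ha0]
      linarith
    calc _ ≤ ‖(‖ξ‖ * a⁻¹) • e₁ d‖ + ‖‖ξ‖ • dil a⁻¹ (Φ.R j ℓ v)‖ := norm_add_le _ _
      _ = ‖ξ‖ * a⁻¹ + ‖ξ‖ * ‖dil a⁻¹ (Φ.R j ℓ v)‖ := by
          rw [norm_smul, norm_smul, he, mul_one, Real.norm_of_nonneg (by positivity), norm_norm]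
      _ ≤ ‖ξ‖ * a⁻¹ + ‖ξ‖ * (a⁻¹ * 2) := by gcongr
      _ ≤ 6 := by linarith

/-- The inverse `U_{j,ℓ}⁻¹ = D_{2^j} R_{j,ℓ}` as a linear automorphism. -/
noncomputable def Uinv (j : ℕ) (ℓ : Fin (Φ.L j + 1)) : Space d ≃ₗ[ℝ] Space d :=
  (Φ.R j ℓ).toLinearEquiv.trans (dilEquiv ((2 : ℝ) ^ (j : ℤ)) (by positivity))

theorem Uinv_symm_apply (j : ℕ) (ℓ : Fin (Φ.L j + 1)) (x : Space d) :
    (Φ.Uinv j ℓ).symm x = Φ.U j ℓ x := by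
  rw [U, zpow_neg]
  rfl

/-- The Jacobian `|det U_{j,ℓ}|`. -/
noncomputable def jac (j : ℕ) (ℓ : Fin (Φ.L j + 1)) : ℝ :=
  |LinearMap.det ((Φ.Uinv j ℓ).symm : Space d →ₗ[ℝ] Space d)|

theorem jac_pos (j : ℕ) (ℓ : Fin (Φ.L j + 1)) : 0 < Φ.jac j ℓ :=
  abs_pos.2 (Φ.Uinv j ℓ).symm.isUnit_det'.ne_zero

theorem integral_comp_Uinv {G : Type*} [NormedAddCommGroup G] [NormedSpace ℝ G]
    (j : ℕ) (ℓ : Fin (Φ.L j + 1)) (F : Space d → G) :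
    ∫ x, F (Φ.Uinv j ℓ x) = Φ.jac j ℓ • ∫ x, F x :=
  integral_comp_linearEquiv _ F

/-- Substituting `ξ = U⁻ᵀ η` writes `ψ_{j,ℓ}` as a rescaled inverse Fourier transform of the
window. -/
theorem psi_eq (j : ℕ) (ℓ : Fin (Φ.L j + 1)) (x : Space d) :
    Φ.psi j ℓ x = (Φ.jac j ℓ)⁻¹ • 𝓕⁻ (fun η => (Φ.window j ℓ η : ℂ)) (Φ.Uinv j ℓ x) := by
  set R := Φ.R j ℓ
  rw [eq_inv_smul_iff₀ (Φ.jac_pos j ℓ).ne', psi, Real.fourierInv_eq, Real.fourierInv_eq,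
    -- `D R` differs from `U⁻ᵀ = R⁻¹ D` by rotations on either side, which preserve the integral.
    ← R.symm.measurePreserving.integral_comp R.symm.toHomeomorph.measurableEmbedding,
    ← R.measurePreserving.integral_comp R.toHomeomorph.measurableEmbedding
      (fun v => Real.fourierChar (inner ℝ v (Φ.Uinv j ℓ x)) • (Φ.window j ℓ v : ℂ)),
    ← Φ.integral_comp_Uinv]
  refine integral_congr_ae (ae_of_all _ fun η => ?_)
  have hinner : inner ℝ (R.symm (Φ.Uinv j ℓ η)) x = inner ℝ (R η) (Φ.Uinv j ℓ x) := by
    rw [← R.inner_map_map, R.apply_symm_apply]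
    exact inner_dil_left _ _ _
  simp only [hinner]
  rfl

theorem continuous_psi (j : ℕ) (ℓ : Fin (Φ.L j + 1)) (hc : ContDiff ℝ 0 (Φ.window j ℓ)) :
    Continuous (Φ.psi j ℓ) := by
  have hg : ContDiff ℝ (0 : ℕ) (fun η => (Φ.window j ℓ η : ℂ)) :=
    Complex.ofRealCLM.contDiff.comp hc
  have hint : Integrable (fun η => (Φ.window j ℓ η : ℂ)) := by
    refine hg.continuous.integrable_of_hasCompactSupport
      (HasCompactSupport.of_support_subset_isCompact (isCompact_closedBall 0 6) fun η hη => ?_)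
    refine Φ.support_window_subset j ℓ fun h => hη ?_
    simp [h]
  have hF : Continuous (𝓕 (fun η => (Φ.window j ℓ η : ℂ))) :=
    VectorFourier.fourierIntegral_continuous Real.continuous_fourierChar
      (by exact continuous_inner) hint
  have heq : Φ.psi j ℓ = fun x =>
      (Φ.jac j ℓ)⁻¹ • 𝓕 (fun η => (Φ.window j ℓ η : ℂ)) (-(Φ.Uinv j ℓ x)) := by
    funext x
    rw [Φ.psi_eq, Real.fourierInv_eq_fourier_neg]
  rw [heq]
  have hU : Continuous (Φ.Uinv j ℓ) := (Φ.Uinv j ℓ).toContinuousLinearEquiv.continuous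
  exact Continuous.const_smul (hF.comp hU.neg) ((Φ.jac j ℓ)⁻¹)

theorem one_add_norm_U_intVec_sq (j : ℕ) (ℓ : Fin (Φ.L j + 1)) (k : Fin d → ℤ) :
    1 + ‖Φ.U j ℓ (intVec k)‖ ^ 2 = ((k 0 : ℝ) / 2 ^ j) ^ 2 + tailNormSq k + 1 := by
  rw [U, LinearIsometryEquiv.norm_map, norm_dil_sq, tailNormSq, zpow_neg, zpow_natCast,
    ← div_eq_inv_mul]
  simp only [intVec]
  ring

theorem norm_U_le (j : ℕ) (ℓ : Fin (Φ.L j + 1)) (x : Space d) : ‖Φ.U j ℓ x‖ ≤ ‖x‖ := by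
  rw [U, LinearIsometryEquiv.norm_map, zpow_neg, zpow_natCast]
  exact norm_dil_le (by positivity) (inv_le_one_of_one_le₀ (one_le_pow₀ one_le_two)) x

theorem exists_norm_fourierInv_window_le {n : ℕ} {N : ℕ∞} (hn : (n : ℕ∞) ≤ N)
    (hΦ : Φ.WindowsBounded N) : ∃ C : ℝ, 0 ≤ C ∧ ∀ j ℓ y,
      ‖𝓕⁻ (fun η => (Φ.window j ℓ η : ℂ)) y‖ ≤ C * ((1 + ‖y‖) ^ n)⁻¹ := by
  have hbd : ∀ p : ℕ, ∃ β : ℝ, 0 ≤ β ∧ (p ≤ n →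
      ∀ j ℓ η, ‖iteratedFDeriv ℝ p (Φ.window j ℓ) η‖ ≤ β) := by
    intro p
    by_cases hp : p ≤ n
    · obtain ⟨β, hβ⟩ := hΦ.2 p (le_trans (by exact_mod_cast hp) hn)
      exact ⟨|β|, abs_nonneg β, fun _ j ℓ η => (hβ j ℓ η).trans (le_abs_self β)⟩
    · exact ⟨0, le_rfl, fun h => absurd h hp⟩
  choose β hβ0 hβ using hbd
  obtain ⟨C, hC0, hC⟩ := exists_norm_fourierInv_le (E := Space d) n 6
    (∑ p ∈ Finset.range (n + 1), β p)
  refine ⟨C, hC0, fun j ℓ y => hC _ ?_ ?_ ?_ y⟩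
  · exact Complex.ofRealCLM.contDiff.comp
      ((hΦ.1 j ℓ).of_le (by exact_mod_cast hn))
  · intro η hη
    refine Φ.support_window_subset j ℓ fun h => hη ?_
    simp [h]
  · intro p hp x
    have h1 : ContDiffAt ℝ p (Φ.window j ℓ) x :=
      ((hΦ.1 j ℓ).of_le (by exact_mod_cast le_trans (by exact_mod_cast hp) hn)).contDiffAt
    have h2 := Complex.ofRealLI.norm_iteratedFDeriv_comp_left h1 le_rfl
    refine (h2.trans_le (hβ p hp j ℓ x)).trans ?_
    exact Finset.single_le_sum (f := β) (fun i _ => hβ0 i)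
      (Finset.mem_range.2 (Nat.lt_succ_of_le hp))

end System

end Ridgelet

theorem lemma4p6 (d : ℕ) [NeZero d] (Φ : Ridgelet.System d) (m : ℕ) (N : ℕ∞)
    (hN : ((2 * m + d + 1 : ℕ) : ℕ∞) ≤ N) (hΦ : Φ.WindowsBounded N) :
    ∃ C : ℝ, 0 < C ∧ ∀ (f : Ridgelet.Space d → ℂ) (A : ℝ),
      MemLp f 2 volume →
      (∀ᵐ x, ‖f x‖ ≤ A * Ridgelet.regAbs x ^ (-(2 * (m : ℤ)))) →
      ∀ (j : ℕ) (ℓ : Fin (Φ.L j + 1)) (k : Fin d → ℤ),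
        Integrable (fun x => conj (Φ.ridgelet j ℓ k x) * f x) ∧
        ‖Φ.coeff f j ℓ k‖ ≤ C * A * ((2 : ℝ) ^ (-(j : ℝ) / 2) /
          (((k 0 : ℝ) / 2 ^ j) ^ 2 + Ridgelet.tailNormSq k + 1) ^ m) := by
  obtain ⟨C₀, hC₀, hG⟩ := Φ.exists_norm_fourierInv_window_le hN hΦ
  set H : Ridgelet.Space d → ℝ := fun z => ((1 + ‖z‖) ^ (d + 1))⁻¹ with hH
  have hHint : Integrable H := by
    have h := integrable_one_add_norm (E := Ridgelet.Space d) (μ := volume) (r := (d + 1 : ℕ))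
      (by simp)
    refine h.congr (ae_of_all _ fun z => ?_)
    simp only [hH]
    rw [Real.rpow_neg (by positivity), Real.rpow_natCast]
  have hI : 0 ≤ ∫ z, H z := integral_nonneg fun z => by positivity
  -- The summand `1` only serves to make the constant positive.
  refine ⟨C₀ * 2 ^ m * (∫ z, H z) + 1, by positivity, fun f A hf hfA j ℓ k => ?_⟩
  have hA : 0 ≤ A := by
    obtain ⟨x, hx⟩ := hfA.exists
    rw [Ridgelet.regAbs_zpow] at hx
    exact nonneg_of_mul_nonneg_left ((norm_nonneg _).trans hx) (by positivity)
  have hδ := Φ.jac_pos j ℓ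
  set δ := Φ.jac j ℓ with hδ_def
  set a := Φ.U j ℓ (Ridgelet.intVec k) with ha
  set W := ((1 + ‖a‖ ^ 2) ^ m)⁻¹ with hW
  set c := (2 : ℝ) ^ (-(j : ℝ) / 2) with hc
  have hc0 : 0 < c := by positivity
  have hUa : Φ.Uinv j ℓ a = Ridgelet.intVec k := by
    rw [ha, ← Φ.Uinv_symm_apply, LinearEquiv.apply_symm_apply]
  have hbound : ∀ᵐ x, ‖conj (Φ.ridgelet j ℓ k x) * f x‖ ≤
      c * δ⁻¹ * C₀ * A * 2 ^ m * W * H (Φ.Uinv j ℓ x - Ridgelet.intVec k) := by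
    filter_upwards [hfA] with x hx
    rw [Ridgelet.regAbs_zpow] at hx
    set z := Φ.Uinv j ℓ x - Ridgelet.intVec k with hz
    have hzU : Φ.Uinv j ℓ (x - a) = z := by rw [map_sub, hUa]
    have hUz : Φ.U j ℓ z = x - a := by
      rw [← hzU, ← Φ.Uinv_symm_apply, LinearEquiv.symm_apply_apply]
    have hψ : ‖Φ.ridgelet j ℓ k x‖ ≤ c * (δ⁻¹ * (C₀ * ((1 + ‖z‖) ^ (2 * m + d + 1))⁻¹)) := by
      rw [Ridgelet.System.ridgelet, norm_mul, Complex.norm_real, Real.norm_of_nonneg hc0.le,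
        Φ.psi_eq, hzU, norm_smul, Real.norm_of_nonneg (inv_nonneg.2 hδ.le)]
      gcongr
      exact hG j ℓ z
    have hP := Ridgelet.inv_mul_inv_weight_le m (d + 1) (a := a) (Φ.norm_U_le j ℓ z)
    rw [hUz, add_sub_cancel] at hP
    rw [norm_mul, RCLike.norm_conj]
    calc ‖Φ.ridgelet j ℓ k x‖ * ‖f x‖
        ≤ c * (δ⁻¹ * (C₀ * ((1 + ‖z‖) ^ (2 * m + d + 1))⁻¹)) * (A * ((1 + ‖x‖ ^ 2) ^ m)⁻¹) := by
          gcongr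
      _ = c * δ⁻¹ * C₀ * A *
          (((1 + ‖z‖) ^ (2 * m + (d + 1)))⁻¹ * ((1 + ‖x‖ ^ 2) ^ m)⁻¹) := by
          rw [← add_assoc]
          ring
      _ ≤ c * δ⁻¹ * C₀ * A * (2 ^ m * ((1 + ‖a‖ ^ 2) ^ m)⁻¹ * ((1 + ‖z‖) ^ (d + 1))⁻¹) := by
          gcongr
      _ = _ := by
          simp only [hH, hW]
          ring
  have hmaj : Integrable fun x =>
      c * δ⁻¹ * C₀ * A * 2 ^ m * W * H (Φ.Uinv j ℓ x - Ridgelet.intVec k) :=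
    (integrable_comp_linearEquiv (Φ.Uinv j ℓ)
      (hHint.comp_sub_right (Ridgelet.intVec k))).const_mul _
  have hmeas : AEStronglyMeasurable (fun x => conj (Φ.ridgelet j ℓ k x) * f x) volume := by
    refine Continuous.aestronglyMeasurable ?_ |>.mul hf.1
    refine Complex.continuous_conj.comp (continuous_const.mul ?_)
    exact (Φ.continuous_psi j ℓ ((hΦ.1 j ℓ).of_le (by simp))).comp (continuous_sub_right _)
  refine ⟨hmaj.mono' hmeas hbound, ?_⟩
  rw [← Φ.one_add_norm_U_intVec_sq j ℓ k, ← ha]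
  calc ‖Φ.coeff f j ℓ k‖
      ≤ ∫ x, c * δ⁻¹ * C₀ * A * 2 ^ m * W * H (Φ.Uinv j ℓ x - Ridgelet.intVec k) :=
        norm_integral_le_of_norm_le hmaj hbound
    _ = c * δ⁻¹ * C₀ * A * 2 ^ m * W * (δ * ∫ z, H z) := by
        rw [integral_const_mul, Φ.integral_comp_Uinv j ℓ fun y => H (y - Ridgelet.intVec k),
          integral_sub_right_eq_self, smul_eq_mul]
    _ = C₀ * 2 ^ m * (∫ z, H z) * A * (c * W) := by
        field_simp
    _ ≤ (C₀ * 2 ^ m * (∫ z, H z) + 1) * A * (c * W) := by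
        gcongr
        linarith
    _ = _ := by rw [hW, div_eq_mul_inv]
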